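/- **Definitions.** Let $m,n'\ge 2$ and let $\pi$ be a partition of $\{0,\dots,m-1\}\times\{0,\dots,n'-1\}$, with associated equivalence relation $\sim$. Let $$\Gamma_\pi=\langle a_0,\dots,a_{m-1},b_0,\dots,b_{n'-1}\mid a_0=b_0=1,\ a_ib_j=a_kb_l \text{ whenever } (i,j)\sim(k,l)\rangle .$$ The partition $\pi$ is *nondegenerate* if $a_0,\dots,a_{m-1}$ are distinct in $\Gamma_\pi$ and $b_0,\dots,b_{n'-1}$ are distinct in $\Gamma_\pi$. For a division ring $K$ and nonzero $r_i,s_j\in K$, it is *realizable with* $(r_i),(s_j)$ if for every class $E$ of $\pi$ the sum $\sum_{(i,j)\in E}r_is_j$ is $1$ if $(0,0)\in E$ and $0$ otherwise; it is *minimally realizable over* $K$ if for some nonzero $(r_i),(s_j)$ it is minimal (with respect to refinement) among the partitions realizable with $(r_i),(s_j)$. It is *row connected* if the equivalence relation on $\{0,\dots,m-1\}$ generated by $i\sim_r k$ whenever $(i,j)\sim(k,l)$ for some $j,l$ has only one class, and *column connected* if the analogous condition holds for columns. $\mathrm{ULIE}^{(1)}_K(m,n')$ is the set of groups $\Gamma_\pi$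 (up to isomorphism) for $\pi$ nondegenerate, minimally realizable over $K$, row connected and column connected. **Statement.** Let $n\ge 2$, and let $\pi$ be the partition of $\{0,\dots,2n\}\times\{0,\dots,2n\}$ generated by the pairings * $(0,1)\sim(1,0)$, $(0,2)\sim(2,0)$, $(1,1)\sim(2,2)$, $(1,2)\sim(2,1)$; * $(2p-1,2q-1)\sim(2p,2q)$ and $(2p-1,2q)\sim(2p,2q-1)$ for $2\le p,q\le n$; * $(0,j)\sim(j,2)$, $(1,j)\sim(j,0)$, $(2,j)\sim(j,1)$ for $3\le j\le 2n$. Then: 1. $\{(0,0)\}$ is a class of $\pi$ and every other class has exactly two elements. 2. $\pi$ is nondegenerate, minimally realizable over $\mathbb F_2$, row connected and column connected; so $\Gamma_\pi$ belongs to $\mathrm{ULIE}^{(1)}_{\mathbb F_2}(2n+1,2n+1)$. 3. There is an isomorphism $$\Gamma_\pi\;\cong\;\mathbb Z_2\times\Big((\mathbb Z_2\times\mathbb Z_2)\rtimes(\underbrace{\mathbb Z*\cdots*\mathbb Z}_{n-1})\Big),$$ where the generator of each free factor $\mathbb Z$ acts by the same automorphism $\alpha$ of $\mathbb Z_2\times\mathbb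 Z_2$, of order $3$, that cycles the nontrivial elements: $(0,1)\mapsto(1,0)\mapsto(1,1)\mapsto(0,1)$. It can be chosen so that $s=a_1^{-1}a_2$ and $a_1$ correspond to the generators $(1,0)$ and $(0,1)$ of $\mathbb Z_2\times\mathbb Z_2$, the elements $a_3,a_5,\dots,a_{2n-1}$ correspond to the generators of the $n-1$ free factors, and $t=a_{j}^{-1}a_{j+1}$ (the same element for all odd $j$ with $3\le j\le 2n-1$) corresponds to the generator of the first factor $\mathbb Z_2$. 4. If $n\ge3$, then $\Gamma_\pi$ is not amenable. 5. $\Gamma_\pi$ is sofic. -/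

import Mathlib

namespace ULIE

/-! Partitions of the grid `Fin m × Fin n` are given by setoids; `π ≤ σ` in the order of setoids
means that `π` is finer than `σ`. -/

section General

/-- The defining relators: `a₀ = 1`, `b₀ = 1`, and `aᵢ bⱼ = aₖ bₗ` whenever `(i,j) ∼ (k,l)`.
The generator `aᵢ` is `Sum.inl i` and the generator `bⱼ` is `Sum.inr j`. -/
def relators {m n : ℕ} (π : Setoid (Fin m × Fin n)) : Set (FreeGroup (Fin m ⊕ Fin n)) :=
  {w | (∃ i : Fin m, i.val = 0 ∧ w = FreeGroup.of (Sum.inl i)) ∨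
    (∃ j : Fin n, j.val = 0 ∧ w = FreeGroup.of (Sum.inr j)) ∨
    ∃ x y : Fin m × Fin n, π x y ∧
      w = FreeGroup.of (Sum.inl x.1) * FreeGroup.of (Sum.inr x.2) *
        (FreeGroup.of (Sum.inl y.1) * FreeGroup.of (Sum.inr y.2))⁻¹}

/-- The group `Γ_π`. -/
abbrev Gam {m n : ℕ} (π : Setoid (Fin m × Fin n)) : Type := PresentedGroup (relators π)

/-- The canonical generator `aᵢ` of `Γ_π`. -/
def a {m n : ℕ} (π : Setoid (Fin m × Fin n)) (i : Fin m) : Gam π := PresentedGroup.of (Sum.inl i)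

/-- The canonical generator `bⱼ` of `Γ_π`. -/
def b {m n : ℕ} (π : Setoid (Fin m × Fin n)) (j : Fin n) : Gam π := PresentedGroup.of (Sum.inr j)

/-- `π` is nondegenerate: the `aᵢ` are distinct and the `bⱼ` are distinct in `Γ_π`. -/
def Nondegenerate {m n : ℕ} (π : Setoid (Fin m × Fin n)) : Prop :=
  Function.Injective (a π) ∧ Function.Injective (b π)

open Classical in
/-- `π` is realizable with the nonzero elements `r₀, …, r_{m-1}, s₀, …, s_{n-1}` of `K`: the sum of
`rᵢ sⱼ` over a class is `1` for the class of `(0,0)` and `0` for every other class. -/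
def RealizableWith {K : Type*} [DivisionRing K] {m n : ℕ} [NeZero m] [NeZero n]
    (r : Fin m → K) (s : Fin n → K) (π : Setoid (Fin m × Fin n)) : Prop :=
  (∀ i, r i ≠ 0) ∧ (∀ j, s j ≠ 0) ∧
    ∀ x : Fin m × Fin n,
      ∑ y ∈ Finset.univ.filter (fun y => π x y), r y.1 * s y.2 = if π x (0, 0) then 1 else 0

/-- `π` is minimally realizable over `K`: for some `r, s` it is minimal among the partitions that
are realizable with `r, s`. -/
def MinimallyRealizable (K : Type*) [DivisionRing K] {m n : ℕ} [NeZero m] [NeZero n]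
    (π : Setoid (Fin m × Fin n)) : Prop :=
  ∃ (r : Fin m → K) (s : Fin n → K), Minimal (RealizableWith r s) π

/-- `π` is row connected. -/
def RowConnected {m n : ℕ} (π : Setoid (Fin m × Fin n)) : Prop :=
  ∀ i i' : Fin m, Relation.EqvGen (fun k k' => ∃ j j' : Fin n, π (k, j) (k', j')) i i'

/-- `π` is column connected. -/
def ColumnConnected {m n : ℕ} (π : Setoid (Fin m × Fin n)) : Prop :=
  ∀ j j' : Fin n, Relation.EqvGen (fun l l' => ∃ i i' : Fin m, π (i, l) (i', l')) j j'

/-- The partitions `π` whose groups `Γ_π` make up `ULIE⁽¹⁾_K(m,n)`. -/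
structure IsULIE1Partition (K : Type*) [DivisionRing K] {m n : ℕ} [NeZero m] [NeZero n]
    (π : Setoid (Fin m × Fin n)) : Prop where
  two_le_left : 2 ≤ m
  two_le_right : 2 ≤ n
  nondegenerate : Nondegenerate π
  minimallyRealizable : MinimallyRealizable K π
  rowConnected : RowConnected π
  columnConnected : ColumnConnected π

/-- `G` is (up to isomorphism) a member of `ULIE⁽¹⁾_K(m,n)`. -/
def IsULIE1Group (K : Type*) [DivisionRing K] (m n : ℕ) [NeZero m] [NeZero n]
    (G : Type*) [Group G] : Prop :=
  ∃ π : Setoid (Fin m × Fin n), IsULIE1Partition K π ∧ Nonempty (G ≃* Gam π)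

/-- `π` consists of the singleton `{(0,0)}` and of pairs. -/
def IsPairPartition {m n : ℕ} [NeZero m] [NeZero n] (π : Setoid (Fin m × Fin n)) : Prop :=
  {y | π (0, 0) y} = {(0, 0)} ∧ ∀ x : Fin m × Fin n, x ≠ (0, 0) → {y | π x y}.ncard = 2

/-- Amenability of a discrete group: there is a left-invariant finitely additive probability
measure on the set of all subsets. -/
def IsAmenable (G : Type*) [Group G] : Prop :=
  ∃ μ : Set G → ℝ, (∀ A, 0 ≤ μ A) ∧ μ Set.univ = 1 ∧
    (∀ A B, Disjoint A B → μ (A ∪ B) = μ A + μ B) ∧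
    ∀ (g : G) (A : Set G), μ ((fun x => g * x) '' A) = μ A

/-- The normalized Hamming distance of two permutations of an `N`-element set. -/
noncomputable def permDist {N : ℕ} (p q : Equiv.Perm (Fin N)) : ℝ :=
  (hammingDist (p : Fin N → Fin N) (q : Fin N → Fin N) : ℝ) / N

/-- Soficity: every finite subset has almost multiplicative, almost free actions on nonempty finite
sets, in the normalized Hamming distance. -/
def IsSofic (G : Type*) [Group G] : Prop :=
  ∀ (F : Finset G) (ε : ℝ), 0 < ε →
    ∃ (N : ℕ) (σ : G → Equiv.Perm (Fin N)), 0 < N ∧ σ 1 = 1 ∧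
      (∀ g ∈ F, ∀ h ∈ F, permDist (σ (g * h)) (σ g * σ h) ≤ ε) ∧
      ∀ g ∈ F, g ≠ 1 → 1 - ε ≤ permDist (σ g) 1

end General

section Family

/-- The pairs of the partition of the `(2n+1) × (2n+1)` grid, rows and columns numbered from `0`. -/
inductive GridPair (n : ℕ) : ℕ × ℕ → ℕ × ℕ → Prop
  | corner_one : GridPair n (0, 1) (1, 0)
  | corner_two : GridPair n (0, 2) (2, 0)
  | cross_diag : GridPair n (1, 1) (2, 2)
  | cross_anti : GridPair n (1, 2) (2, 1)
  | block_diag (p q : ℕ) (hp : 2 ≤ p ∧ p ≤ n) (hq : 2 ≤ q ∧ q ≤ n) :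
      GridPair n (2 * p - 1, 2 * q - 1) (2 * p, 2 * q)
  | block_anti (p q : ℕ) (hp : 2 ≤ p ∧ p ≤ n) (hq : 2 ≤ q ∧ q ≤ n) :
      GridPair n (2 * p - 1, 2 * q) (2 * p, 2 * q - 1)
  | row_zero (j : ℕ) (hj : 3 ≤ j ∧ j ≤ 2 * n) : GridPair n (0, j) (j, 2)
  | row_one (j : ℕ) (hj : 3 ≤ j ∧ j ≤ 2 * n) : GridPair n (1, j) (j, 0)
  | row_two (j : ℕ) (hj : 3 ≤ j ∧ j ≤ 2 * n) : GridPair n (2, j) (j, 1)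

/-- The partition `π` of the `(2n+1) × (2n+1)` grid generated by these pairs. -/
def gridPartition (n : ℕ) : Setoid (Fin (2 * n + 1) × Fin (2 * n + 1)) :=
  Relation.EqvGen.setoid fun x y => GridPair n (x.1.val, x.2.val) (y.1.val, y.2.val)

/-- The cyclic group of order two, written multiplicatively. -/
abbrev C2 : Type := Multiplicative (ZMod 2)

/-- The generator of the cyclic group of order two. -/
def c : C2 := Multiplicative.ofAdd 1

/-- The automorphism of `C2 × C2` that cycles the nontrivial elements:
`(1, c) ↦ (c, 1) ↦ (c, c) ↦ (1, c)`. -/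
def alpha : MulAut (C2 × C2) where
  toFun v := (v.1 * v.2, v.1)
  invFun v := (v.2, v.1 * v.2)
  left_inv := by decide
  right_inv := by decide
  map_mul' := by decide

/-- The free product of `k` copies of `ℤ`. -/
abbrev FreeProdZ (k : ℕ) : Type := Monoid.CoprodI fun _ : Fin k => Multiplicative ℤ

/-- The generator of the `i`-th free factor. -/
def gen {k : ℕ} (i : Fin k) : FreeProdZ k :=
  Monoid.CoprodI.of (M := fun _ : Fin k => Multiplicative ℤ) (i := i) (Multiplicative.ofAdd 1)

/-- The action of the free product in which the generator of each factor acts by `alpha`. -/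
def act (k : ℕ) : FreeProdZ k →* MulAut (C2 × C2) :=
  Monoid.CoprodI.lift fun _ : Fin k => zpowersHom (MulAut (C2 × C2)) alpha

/-- The group `ℤ₂ × ((ℤ₂ × ℤ₂) ⋊ (ℤ * ⋯ * ℤ))` with `k` free factors. -/
abbrev Model (k : ℕ) : Type := C2 × ((C2 × C2) ⋊[act k] FreeProdZ k)

end Family

end ULIE

/-! The relations can be solved. The pairs among indices at most 2 give `b₁ = a₁`, `b₂ = a₂`, make
`a₁, a₂` commute and have equal squares, so `s = a₁⁻¹a₂` has `s² = 1`. For `j ≥ 3`, eliminating `bⱼ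
= a₁⁻¹aⱼ` from the three row relations shows that conjugation by `aⱼ` sends `a₁ ↦ s ↦ s a₁`. Hence
`a₁² = 1`, and every such `aⱼ` acts on `⟨s, a₁⟩` as `alpha`. So `aⱼ⁻¹aₖ` centralizes `⟨s, a₁⟩`, and
the block relations then force all `a_{2p-1}⁻¹a_{2p}` to be one central involution `t`. No relation
remains between `a₃, a₅, …`.

Conversely, the model satisfies all the relations (`modelA_mul_modelB`), and `exists_model_hom`
gives the inverse homomorphism (`exists_gam_mulEquiv_model`). Nondegeneracy is read off in the
model. Non-amenability comes from the quotient `ℤ * ⋯ * ℤ`, and soficity from residual finiteness.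
Over `𝔽₂` all coefficients can be `1`, since classes other than `{(0,0)}` are pairs. -/

namespace ULIE

/-! ### Soficity from residual finiteness -/

section Sofic

theorem permDist_self {N : ℕ} (p : Equiv.Perm (Fin N)) : permDist p p = 0 := by
  simp [permDist]

theorem permDist_eq_one {N : ℕ} (hN : 0 < N) {p q : Equiv.Perm (Fin N)} (h : ∀ i, p i ≠ q i) :
    permDist p q = 1 := by
  have : hammingDist (p : Fin N → Fin N) q = N := by
    simp [hammingDist, h]
  rw [permDist, this, div_self (by positivity)]

/-- Residually finite groups are sofic. -/
theorem isSofic_of_residuallyFinite (G : Type*) [Group G] [Group.ResiduallyFinite G] :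
    IsSofic G := by
  classical
  intro F ε hε
  have hex : ∀ g : G, ∃ H : FiniteIndexNormalSubgroup G, g ≠ 1 → g ∉ H := fun g ↦ by
    by_cases hg : g = 1
    · exact ⟨.ofSubgroup ⊤, fun h ↦ absurd hg h⟩
    · obtain ⟨H, hH⟩ := Group.exists_finiteIndexNormalSubgroup_notMem g hg
      exact ⟨H, fun _ ↦ hH⟩
  choose H hH using hex
  -- One finite quotient `G ⧸ K` detects all nontrivial elements of `F`. Its left regular action is
  -- exactly multiplicative, and these elements act without fixed points, at distance exactly `1`
  -- from the identity.
  let K : Subgroup G := ⨅ g : F, (H g).toSubgroup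
  have hKn : K.Normal := Subgroup.normal_iInf_normal fun g ↦ inferInstance
  have hKf : K.FiniteIndex := Subgroup.finiteIndex_iInf fun g ↦ inferInstance
  have hKF : ∀ g ∈ F, g ≠ 1 → g ∉ K := fun g hg h1 hK ↦
    hH g h1 ((Subgroup.mem_iInf.mp hK) ⟨g, hg⟩)
  let e : G ⧸ K ≃ Fin (Nat.card (G ⧸ K)) := Finite.equivFin _
  have hpos : 0 < Nat.card (G ⧸ K) := Nat.card_pos
  let σ : G →* Equiv.Perm (Fin (Nat.card (G ⧸ K))) :=
    (e.permCongrHom.toMonoidHom.comp (MulAction.toPermHom (G ⧸ K) (G ⧸ K))).comp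
      (QuotientGroup.mk' K)
  refine ⟨_, σ, hpos, map_one σ, fun g _ h _ ↦ ?_, fun g hg h1 ↦ ?_⟩
  · rw [map_mul, permDist_self]
    exact hε.le
  · rw [permDist_eq_one hpos]
    · linarith
    · intro i hi
      have h2 : e ((g : G ⧸ K) * e.symm i) = i := hi
      have h3 : (g : G ⧸ K) * e.symm i = e.symm i := e.eq_symm_apply.mpr h2
      rw [mul_eq_right, QuotientGroup.eq_one_iff] at h3
      exact hKF g hg h1 h3

theorem residuallyFinite_of_mulEquiv {G G' : Type*} [Group G] [Group G'] (e : G ≃* G')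
    [Group.ResiduallyFinite G'] : Group.ResiduallyFinite G := by
  rw [Group.residuallyFinite_iff_forall_finiteIndexNormalSubgroup]
  intro g hg
  have := Group.eq_one_iff_forall_finiteIndexNormalSubroup (e g) fun K ↦ hg (K.comap e.toMonoidHom)
  simpa using this

end Sofic

/-! ### Residual finiteness of free products of `ℤ` and of finite-by-residually-finite semidirect
products -/

section ResiduallyFinite

/-- The partially defined left translation by `g` on a finite set extends to a permutation. -/
theorem exists_perm_extending_mul {G : Type*} [Group G] (S : Set G) [Finite S] (g : G) :
    ∃ σ : Equiv.Perm S, ∀ x : S, g * x ∈ S → (σ x : G) = g * x := by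
  classical
  have := Fintype.ofFinite S
  -- The places where translation by `g` stays in `S` biject with those where translation by `g⁻¹`
  -- does; finiteness of `S` lets this extend to all of `S`.
  let e : {x : S // g * x ∈ S} ≃ {y : S // g⁻¹ * y ∈ S} :=
    { toFun x := ⟨⟨g * x, x.2⟩, by simp⟩
      invFun y := ⟨⟨g⁻¹ * y, y.2⟩, by simp⟩
      left_inv x := by simp
      right_inv y := by simp }
  exact ⟨e.extendSubtype, fun x hx ↦ by rw [e.extendSubtype_apply_of_mem x hx]; rfl⟩

theorem closure_range_gen (k : ℕ) : Subgroup.closure (Set.range (gen (k := k))) = ⊤ := by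
  rw [eq_top_iff]
  rintro x -
  induction x using Monoid.CoprodI.induction_on with
  | one => exact one_mem _
  | of i m =>
    have : Monoid.CoprodI.of (M := fun _ : Fin k ↦ Multiplicative ℤ) (i := i) m =
        gen i ^ m.toAdd := by
      rw [gen, ← map_zpow, ← ofAdd_zsmul, zsmul_one]
      rfl
    rw [this]
    exact zpow_mem (Subgroup.subset_closure (Set.mem_range_self i)) _
  | mul x y hx hy => exact mul_mem hx hy

theorem lift_gen_surjective (k : ℕ) :
    Function.Surjective (FreeGroup.lift (gen (k := k))) := by
  rw [← MonoidHom.range_eq_top, FreeGroup.range_lift_eq_closure, closure_range_gen]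

@[simp]
theorem lift_zpowersHom_gen {k : ℕ} {G : Type*} [Group G] (f : Fin k → G) (i : Fin k) :
    Monoid.CoprodI.lift (fun i ↦ zpowersHom G (f i)) (gen i) = f i := by
  simp [gen]

/-- Let `S` be the finite set of elements spelled by the suffixes of a word for `w`. Complete the
left translation by each generator to a permutation of `S`. Reading the word from the right then
moves `1` through the suffixes to `w ≠ 1`, so `w` acts nontrivially on `S`. -/
instance freeProdZ_residuallyFinite (k : ℕ) : Group.ResiduallyFinite (FreeProdZ k) := by
  apply Group.residuallyFinite_of_forall_exists_finite_monoidHom.{0}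
  intro w hw
  obtain ⟨x, rfl⟩ := lift_gen_surjective k w
  let P : List (Fin k × Bool) → FreeProdZ k := fun L ↦ FreeGroup.lift gen (FreeGroup.mk L)
  let S : Set (FreeProdZ k) := P '' {L | L ∈ x.toWord.tails}
  have : Finite S := ((List.finite_toSet x.toWord.tails).image P).to_subtype
  choose σ hσ using fun i : Fin k ↦ exists_perm_extending_mul S (gen i)
  have hσ' : ∀ (i : Fin k) (x : S), (gen i)⁻¹ * (x : FreeProdZ k) ∈ S →
      (((σ i)⁻¹ x : S) : FreeProdZ k) = (gen i)⁻¹ * x := by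
    intro i x hx
    have : σ i ⟨_, hx⟩ = x := Subtype.ext <| by rw [hσ i ⟨_, hx⟩ (by simp)]; simp
    exact congrArg Subtype.val ((Equiv.Perm.inv_eq_iff_eq).mpr this.symm)
  let φ : FreeProdZ k →* Equiv.Perm S :=
    Monoid.CoprodI.lift fun i ↦ zpowersHom (Equiv.Perm S) (σ i)
  have hφ : ∀ i, φ (gen i) = σ i := fun i ↦ lift_zpowersHom_gen σ i
  have h1 : (1 : FreeProdZ k) ∈ S := ⟨[], by simp, by simp [P]⟩
  have key : ∀ L, L <:+ x.toWord → ((φ (P L) ⟨1, h1⟩ : S) : FreeProdZ k) = P L := by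
    intro L
    induction L with
    | nil => intro _; simp [P]
    | cons l L ih =>
      intro hL
      have hL' : L <:+ x.toWord := (List.suffix_cons l L).trans hL
      have hmem : P (l :: L) ∈ S := ⟨_, by simpa using hL, rfl⟩
      have hval := ih hL'
      obtain ⟨i, _ | _⟩ := l
      · have hP : P ((i, false) :: L) = (gen i)⁻¹ * P L := by simp [P, FreeGroup.lift_mk]
        rw [hP] at hmem ⊢
        rw [← hval] at hmem
        rw [map_mul, map_inv, hφ, Equiv.Perm.mul_apply, hσ' _ _ hmem, hval]
      · have hP : P ((i, true) :: L) = gen i * P L := by simp [P, FreeGroup.lift_mk]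
        rw [hP] at hmem ⊢
        rw [← hval] at hmem
        rw [map_mul, hφ, Equiv.Perm.mul_apply, hσ _ _ hmem, hval]
  have hx : P x.toWord = FreeGroup.lift gen x := by simp only [P, FreeGroup.mk_toWord]
  refine ⟨Equiv.Perm S, inferInstance, inferInstance, φ, fun h ↦ hw ?_⟩
  have := key x.toWord (List.suffix_refl _)
  rw [hx, h] at this
  exact this.symm

/-- The semidirect product of a finite group and a residually finite group is residually finite. -/
instance semidirectProduct_residuallyFinite {N G : Type} [Group N] [Finite N] [Group G]
    [Group.ResiduallyFinite G] (φ : G →* MulAut N) : Group.ResiduallyFinite (N ⋊[φ] G) := by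
  rw [Group.residuallyFinite_iff_forall_finiteIndex]
  intro g hg
  have hr : g.right = 1 := Group.eq_one_iff_forall_finiteIndexNormalSubroup g.right fun K ↦
    hg (K.comap SemidirectProduct.rightHom).toSubgroup
  -- Replacing `G` by the finite group `Aut N` leaves the left component unchanged, so a finite
  -- quotient detects it.
  let ψ : N ⋊[φ] G →* N ⋊[MonoidHom.id (MulAut N)] MulAut N :=
    SemidirectProduct.map (MonoidHom.id N) φ fun g ↦ rfl
  have : Finite (MulAut N) := Finite.of_injective _ DFunLike.coe_injective
  have : Finite (N ⋊[MonoidHom.id (MulAut N)] MulAut N) :=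
    Finite.of_equiv _ SemidirectProduct.equivProd.symm
  have hψ : ψ g = 1 := by
    have := hg ψ.ker
    rwa [MonoidHom.mem_ker] at this
  have hl : g.left = 1 := congrArg SemidirectProduct.left hψ
  ext1
  exacts [hl, hr]

end ResiduallyFinite

/-! ### Non-amenability by a paradoxical decomposition -/

section Amenable

/-- The elements of a free product whose reduced word starts with a letter of the factor `i`. -/
def startsWith {k : ℕ} (i : Fin k) : Set (FreeProdZ k) :=
  {x | (Monoid.CoprodI.Word.equiv x).fstIdx = some i}

/-- No cancellation occurs when the new letter meets a word starting in another factor. -/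
theorem of_mul_mem_startsWith {k : ℕ} {i : Fin k} {m : Multiplicative ℤ} (hm : m ≠ 1)
    {x : FreeProdZ k} (hx : x ∉ startsWith i) :
    Monoid.CoprodI.of (M := fun _ : Fin k ↦ Multiplicative ℤ) (i := i) m * x ∈ startsWith i := by
  let w := Monoid.CoprodI.Word.equiv x
  have hw : w.prod = x := Monoid.CoprodI.Word.equiv.symm_apply_apply x
  let w' := Monoid.CoprodI.Word.cons (M := fun _ : Fin k ↦ Multiplicative ℤ) m w hx hm
  have hw' : w'.prod = Monoid.CoprodI.of (M := fun _ : Fin k ↦ Multiplicative ℤ) (i := i) m * x := by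
    rw [← hw]
    exact Monoid.CoprodI.Word.prod_cons i m w hm hx
  have heq : Monoid.CoprodI.Word.equiv w'.prod = w' :=
    Monoid.CoprodI.Word.equiv.apply_symm_apply w'
  rw [← hw', startsWith, Set.mem_ofPred_eq, heq]
  exact Monoid.CoprodI.Word.fstIdx_cons (M := fun _ : Fin k ↦ Multiplicative ℤ) m w hx hm

/-- A group with a surjection onto a free product of at least two infinite cyclic groups is not
amenable. -/
theorem not_isAmenable_of_surjective {k : ℕ} (hk : 2 ≤ k) {G : Type*} [Group G]
    (f : G →* FreeProdZ k) (hf : Function.Surjective f) : ¬ IsAmenable G := by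
  rintro ⟨μ, hpos, huniv, hadd, hinv⟩
  have hcompl : ∀ A, μ A + μ Aᶜ = 1 := fun A ↦ by
    rw [← hadd _ _ disjoint_compl_right, Set.union_compl_self, huniv]
  have hmono : ∀ A B, A ⊆ B → μ A ≤ μ B := fun A B h ↦ by
    have := hadd A (B \ A) Set.disjoint_sdiff_right
    rw [Set.union_sdiff_cancel h] at this
    linarith [hpos (B \ A)]
  -- The translates of the complement by `g` and `g²` are disjoint and both land in the set of words
  -- starting in factor `i`. That set therefore has mass at least `2/3`, impossible for two disjoint
  -- sets.
  have hsmall : ∀ i : Fin k, 2 * μ (f ⁻¹' (startsWith i))ᶜ ≤ μ (f ⁻¹' (startsWith i)) := by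
    intro i
    obtain ⟨g, hg⟩ := hf (gen i)
    set A := f ⁻¹' (startsWith i) with hA
    have hstep : ∀ m : ℕ, m ≠ 0 → ∀ x ∉ A, g ^ m * x ∈ A := by
      intro m hm x hx
      have : f (g ^ m * x) = Monoid.CoprodI.of (M := fun _ : Fin k ↦ Multiplicative ℤ) (i := i)
          (Multiplicative.ofAdd 1 ^ m) * f x := by
        rw [map_mul, map_pow, hg, map_pow, gen]
      rw [hA, Set.mem_preimage, this]
      refine of_mul_mem_startsWith ?_ hx
      rw [← ofAdd_nsmul]
      simpa using hm
    have hd : Disjoint ((fun x ↦ g * x) '' Aᶜ) ((fun x ↦ g ^ 2 * x) '' Aᶜ) := by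
      rw [Set.disjoint_left]
      rintro _ ⟨x, hx, rfl⟩ ⟨y, hy, hxy⟩
      have : x = g ^ 1 * y := by
        simp only [pow_two, mul_assoc, mul_right_inj] at hxy
        simp [hxy]
      exact hx (this ▸ hstep 1 one_ne_zero y hy)
    have hsub : (fun x ↦ g * x) '' Aᶜ ∪ (fun x ↦ g ^ 2 * x) '' Aᶜ ⊆ A := by
      rintro _ (⟨x, hx, rfl⟩ | ⟨x, hx, rfl⟩)
      · simpa using hstep 1 one_ne_zero x hx
      · exact hstep 2 two_ne_zero x hx
    have := hmono _ _ hsub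
    rw [hadd _ _ hd, hinv, hinv] at this
    linarith
  have h0 := hsmall ⟨0, by omega⟩
  have h1 := hsmall ⟨1, by omega⟩
  have hsub : f ⁻¹' (startsWith ⟨0, by omega⟩) ⊆ (f ⁻¹' (startsWith (k := k) ⟨1, by omega⟩))ᶜ := by
    intro x hx hx'
    have h : (some (⟨0, by omega⟩ : Fin k)) = some ⟨1, by omega⟩ :=
      (show _ = _ from hx).symm.trans hx'
    simp at h
  have := hmono _ _ hsub
  linarith [hcompl (f ⁻¹' (startsWith ⟨0, by omega⟩)),
    hcompl (f ⁻¹' (startsWith (k := k) ⟨1, by omega⟩))]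

end Amenable

/-! ### The pair partition: classes, minimal realizability, connectedness -/

section PairPartition

/-- The other element of the pair of `gridPartition` that contains a given position; the position
`(0, 0)` is fixed. -/
def mate (x : ℕ × ℕ) : ℕ × ℕ :=
  if x.1 ≤ 2 then
    if x.2 ≤ 2 then
      if x.1 = 0 ∨ x.2 = 0 then (x.2, x.1) else (3 - x.1, 3 - x.2)
    -- Row `i ≤ 2` goes to column `i - 1` modulo `3`; the next branch inverts this shift.
    else (x.2, (x.1 + 2) % 3)
  else if x.2 ≤ 2 then ((x.2 + 1) % 3, x.1)
  else (if x.1 % 2 = 1 then x.1 + 1 else x.1 - 1, if x.2 % 2 = 1 then x.2 + 1 else x.2 - 1)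

theorem mate_mate (x : ℕ × ℕ) : mate (mate x) = x := by
  obtain ⟨i, j⟩ := x
  unfold mate
  grind

theorem mate_ne_self {x : ℕ × ℕ} (hx : x ≠ (0, 0)) : mate x ≠ x := by
  obtain ⟨i, j⟩ := x
  simp only [ne_eq, Prod.mk.injEq] at hx
  unfold mate
  grind

theorem GridPair.mate_eq {n : ℕ} {x y : ℕ × ℕ} (h : GridPair n x y) : mate x = y := by
  cases h <;> unfold mate <;> grind

theorem GridPair.lt {n : ℕ} (hn : 2 ≤ n) {x y : ℕ × ℕ} (h : GridPair n x y) :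
    x.1 < 2 * n + 1 ∧ x.2 < 2 * n + 1 ∧ y.1 < 2 * n + 1 ∧ y.2 < 2 * n + 1 := by
  cases h <;> dsimp only <;> omega

/-- Converse to `GridPair.mate_eq`. The disjunction is needed because each pair is listed in one
orientation only. -/
theorem gridPair_mate {n : ℕ} {i j : ℕ} (h0 : (i, j) ≠ (0, 0))
    (hi : i < 2 * n + 1) (hj : j < 2 * n + 1) :
    GridPair n (i, j) (mate (i, j)) ∨ GridPair n (mate (i, j)) (i, j) := by
  by_cases hi2 : i ≤ 2 <;> by_cases hj2 : j ≤ 2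
  · interval_cases i <;> interval_cases j
    · exact absurd rfl h0
    · exact .inl .corner_one
    · exact .inl .corner_two
    · exact .inr .corner_one
    · exact .inl .cross_diag
    · exact .inl .cross_anti
    · exact .inr .corner_two
    · exact .inr .cross_anti
    · exact .inr .cross_diag
  · left
    have hj' : 3 ≤ j ∧ j ≤ 2 * n := by omega
    interval_cases i
    · simpa [mate, hj2] using GridPair.row_zero j hj'
    · simpa [mate, hj2] using GridPair.row_one j hj'
    · simpa [mate, hj2] using GridPair.row_two j hj'
  · right
    have hi' : 3 ≤ i ∧ i ≤ 2 * n := by omega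
    interval_cases j
    · simpa [mate, hi2] using GridPair.row_one i hi'
    · simpa [mate, hi2] using GridPair.row_two i hi'
    · simpa [mate, hi2] using GridPair.row_zero i hi'
  · obtain ⟨p, hp | hp⟩ : ∃ p, i = 2 * p - 1 ∨ i = 2 * p := ⟨(i + 1) / 2, by omega⟩ <;>
    obtain ⟨q, hq | hq⟩ : ∃ q, j = 2 * q - 1 ∨ j = 2 * q := ⟨(j + 1) / 2, by omega⟩ <;>
    have hp' : 2 ≤ p ∧ p ≤ n := by omega
    all_goals have hq' : 2 ≤ q ∧ q ≤ n := by omega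
    · have h := GridPair.block_diag p q hp' hq'
      rw [hp, hq, h.mate_eq]; exact .inl h
    · have h := GridPair.block_anti p q hp' hq'
      rw [hp, hq, h.mate_eq]; exact .inl h
    · have h := GridPair.block_anti p q hp' hq'
      have hm : mate (2 * p, 2 * q - 1) = (2 * p - 1, 2 * q) := by rw [← h.mate_eq, mate_mate]
      rw [hp, hq, hm]; exact .inr h
    · have h := GridPair.block_diag p q hp' hq'
      have hm : mate (2 * p, 2 * q) = (2 * p - 1, 2 * q - 1) := by rw [← h.mate_eq, mate_mate]
      rw [hp, hq, hm]; exact .inr h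

theorem gridPartition_of_gridPair {n : ℕ} {x y : Fin (2 * n + 1) × Fin (2 * n + 1)}
    (h : GridPair n (x.1.val, x.2.val) (y.1.val, y.2.val)) : gridPartition n x y :=
  Relation.EqvGen.rel _ _ h

/-- The classes of `gridPartition` are the orbits of an involution fixing only `(0, 0)`. -/
theorem exists_gridMate {n : ℕ} (hn : 2 ≤ n) :
    ∃ M : Fin (2 * n + 1) × Fin (2 * n + 1) → Fin (2 * n + 1) × Fin (2 * n + 1),
      M (0, 0) = (0, 0) ∧ (∀ x, x ≠ (0, 0) → M x ≠ x ∧ M x ≠ (0, 0)) ∧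
      ∀ x y, gridPartition n x y ↔ y = x ∨ y = M x := by
  let v : Fin (2 * n + 1) × Fin (2 * n + 1) → ℕ × ℕ := fun x ↦ (x.1.val, x.2.val)
  have hv : Function.Injective v := fun x y h ↦ by
    simp only [v, Prod.mk.injEq, Fin.val_inj] at h
    exact Prod.ext h.1 h.2
  have hv0 : v (0, 0) = (0, 0) := rfl
  have hex : ∀ x, ∃ y, v y = mate (v x) := by
    intro x
    suffices h : (mate (v x)).1 < 2 * n + 1 ∧ (mate (v x)).2 < 2 * n + 1 from
      ⟨(⟨_, h.1⟩, ⟨_, h.2⟩), rfl⟩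
    by_cases h0 : v x = (0, 0)
    · rw [h0]; simp [mate]
    · rcases gridPair_mate h0 x.1.2 x.2.2 with h | h
      · exact (h.lt hn).2.2
      · exact ⟨(h.lt hn).1, (h.lt hn).2.1⟩
  choose M hM using hex
  have hMM : ∀ x, M (M x) = x := fun x ↦ hv <| by rw [hM, hM, mate_mate]
  have hM0 : M (0, 0) = (0, 0) := hv <| by rw [hM]; rfl
  have hne : ∀ x, x ≠ (0, 0) → v x ≠ (0, 0) := fun x hx h ↦ hx (hv (h.trans hv0.symm))
  refine ⟨M, hM0, fun x hx ↦ ⟨fun h ↦ ?_, fun h ↦ ?_⟩, fun x y ↦ ⟨fun h ↦ ?_, ?_⟩⟩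
  · exact mate_ne_self (hne x hx) (by rw [← hM, h])
  · exact hx (by rw [← hMM x, h, hM0])
  -- Since `M` is an involution, "equal or exchanged by `M`" is already an equivalence relation, so
  -- generating adds nothing.
  · induction h with
    | rel x y h => exact .inr (hv <| by rw [hM]; exact h.mate_eq.symm)
    | refl x => exact .inl rfl
    | symm x y _ ih =>
      rcases ih with rfl | rfl
      · exact .inl rfl
      · exact .inr (hMM x).symm
    | trans x y z _ _ ih₁ ih₂ =>
      rcases ih₁ with rfl | rfl <;> rcases ih₂ with rfl | rfl
      · exact .inl rfl
      · exact .inr rfl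
      · exact .inr rfl
      · exact .inl (hMM x)
  · rintro (rfl | rfl)
    · exact (gridPartition n).refl' _
    · by_cases hx : x = (0, 0)
      · rw [hx, hM0]
      · have h := gridPair_mate (n := n) (hne x hx) x.1.2 x.2.2
        rw [show ((x.1.val, x.2.val) : ℕ × ℕ) = v x from rfl, ← hM] at h
        rcases h with h | h
        · exact gridPartition_of_gridPair h
        · exact Setoid.symm' _ (gridPartition_of_gridPair h)

theorem isPairPartition_gridPartition {n : ℕ} (hn : 2 ≤ n) :
    IsPairPartition (gridPartition n) := by
  obtain ⟨M, hM0, hM, hrel⟩ := exists_gridMate hn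
  have hset : ∀ x, {y | gridPartition n x y} = {x, M x} := fun x ↦ by
    ext y
    simp [hrel]
  refine ⟨?_, fun x hx ↦ ?_⟩
  · rw [hset, hM0, Set.pair_eq_singleton]
  · rw [hset, Set.ncard_pair (hM x hx).1.symm]

-- With all coefficients `1`, a class sum is the class size modulo `2`. A strictly finer partition
-- would split some pair into singletons, whose sums are `1` instead of `0`.
open Classical in
theorem minimallyRealizable_gridPartition {n : ℕ} (hn : 2 ≤ n) :
    MinimallyRealizable (ZMod 2) (gridPartition n) := by
  obtain ⟨M, hM0, hM, hrel⟩ := exists_gridMate hn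
  have hnot : ∀ x, x ≠ (0, 0) → ¬ gridPartition n x (0, 0) := fun x hx h ↦ by
    rcases (hrel _ _).mp h with h | h
    exacts [hx h.symm, (hM x hx).2 h.symm]
  refine ⟨fun _ ↦ 1, fun _ ↦ 1, ⟨fun _ ↦ one_ne_zero, fun _ ↦ one_ne_zero, fun x ↦ ?_⟩, ?_⟩
  · have hset : Finset.univ.filter (fun y ↦ gridPartition n x y) = {x, M x} := by
      ext y
      simp [hrel]
    rw [hset]
    by_cases hx : x = (0, 0)
    · rw [hx, hM0, if_pos ((gridPartition n).refl' _)]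
      simp
    · rw [if_neg (hnot x hx), Finset.sum_pair (hM x hx).1.symm]
      exact CharTwo.add_self_eq_zero _
  · rintro σ ⟨-, -, hσ⟩ hle x y hxy
    rcases (hrel x y).mp hxy with rfl | rfl
    · exact σ.refl' _
    by_cases hx : x = (0, 0)
    · rw [hx, hM0]
    by_contra hcon
    have hset : Finset.univ.filter (fun y ↦ σ x y) = {x} := by
      ext y
      simp only [Finset.mem_filter, Finset.mem_univ, true_and, Finset.mem_singleton]
      refine ⟨fun h ↦ ?_, fun h ↦ h ▸ σ.refl' _⟩
      rcases (hrel x y).mp (hle h) with h' | rfl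
      exacts [h', absurd h hcon]
    have := hσ x
    rw [hset, if_neg fun h ↦ hnot x hx (hle h)] at this
    simp at this

/-- Row `0` is directly linked to every row; column `0` plays the same role for columns. -/
theorem rowConnected_gridPartition {n : ℕ} (hn : 2 ≤ n) : RowConnected (gridPartition n) := by
  have h0 : ∀ i : Fin (2 * n + 1), Relation.EqvGen
      (fun k k' ↦ ∃ j j' : Fin (2 * n + 1), gridPartition n (k, j) (k', j')) ⟨0, by omega⟩ i := by
    rintro ⟨i, hi⟩
    rcases (by omega : i = 0 ∨ i = 1 ∨ i = 2 ∨ 3 ≤ i) with rfl | rfl | rfl | h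
    · exact .refl _
    · exact .rel _ _ ⟨⟨1, by omega⟩, ⟨0, by omega⟩, gridPartition_of_gridPair .corner_one⟩
    · exact .rel _ _ ⟨⟨2, by omega⟩, ⟨0, by omega⟩, gridPartition_of_gridPair .corner_two⟩
    · exact .rel _ _ ⟨⟨i, hi⟩, ⟨2, by omega⟩,
        gridPartition_of_gridPair (.row_zero i ⟨h, by omega⟩)⟩
  exact fun i i' ↦ .trans _ _ _ (.symm _ _ (h0 i)) (h0 i')

theorem columnConnected_gridPartition {n : ℕ} (hn : 2 ≤ n) :
    ColumnConnected (gridPartition n) := by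
  have h0 : ∀ i : Fin (2 * n + 1), Relation.EqvGen
      (fun l l' ↦ ∃ i i' : Fin (2 * n + 1), gridPartition n (i, l) (i', l')) i ⟨0, by omega⟩ := by
    rintro ⟨i, hi⟩
    rcases (by omega : i = 0 ∨ i = 1 ∨ i = 2 ∨ 3 ≤ i) with rfl | rfl | rfl | h
    · exact .refl _
    · exact .rel _ _ ⟨⟨0, by omega⟩, ⟨1, by omega⟩, gridPartition_of_gridPair .corner_one⟩
    · exact .rel _ _ ⟨⟨0, by omega⟩, ⟨2, by omega⟩, gridPartition_of_gridPair .corner_two⟩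
    · exact .rel _ _ ⟨⟨1, by omega⟩, ⟨i, hi⟩,
        gridPartition_of_gridPair (.row_one i ⟨h, by omega⟩)⟩
  exact fun i i' ↦ .trans _ _ _ (h0 i) (.symm _ _ (h0 i'))

end PairPartition

/-! ### The relations and distinctness of generators in the model group -/

section Model

/-- The `i`-th generator of the free product, or `1` if there is no such generator. -/
def genN (k i : ℕ) : FreeProdZ k := if h : i < k then gen ⟨i, h⟩ else 1

theorem genN_of_lt {k i : ℕ} (h : i < k) : genN k i = gen ⟨i, h⟩ := dif_pos h

@[simp]
theorem act_gen {k : ℕ} (i : Fin k) : act k (gen i) = alpha := lift_zpowersHom_gen (fun _ ↦ alpha) i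

/-- The images of the generators `aᵢ` in the model group. -/
def modelA (k : ℕ) : ℕ → Model k
  | 0 => 1
  | 1 => (1, SemidirectProduct.inl (1, c))
  | 2 => (1, SemidirectProduct.inl (c, c))
  -- Indices `2i + 3` and `2i + 4` share the free generator `i`; the parity of `j` decides whether
  -- the central involution appears.
  | j + 3 => (c ^ j, SemidirectProduct.inr (genN k (j / 2)))

/-- The images of the generators `bⱼ` in the model group. -/
def modelB (k : ℕ) : ℕ → Model k
  -- This is `a₁⁻¹aⱼ`, as `a₁` is an involution.
  | j + 3 => modelA k 1 * modelA k (j + 3)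
  | j => modelA k j

theorem c_mul_c : c * c = 1 := by decide

theorem orderOf_alpha : orderOf alpha = 3 := by
  have : Fact (Nat.Prime 3) := ⟨Nat.prime_three⟩
  refine orderOf_eq_prime ?_ ?_
  · ext1 x
    revert x
    decide
  · intro h
    have := DFunLike.congr_fun h (1, c)
    revert this
    decide

theorem inr_genN_mul_inl {k i : ℕ} (h : i < k) (v : C2 × C2) :
    (SemidirectProduct.inr (genN k i) * SemidirectProduct.inl v : (C2 × C2) ⋊[act k] FreeProdZ k) =
      SemidirectProduct.inl (alpha v) * SemidirectProduct.inr (genN k i) := by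
  rw [genN_of_lt h, ← act_gen ⟨i, h⟩, SemidirectProduct.inl_aut, map_inv,
    inv_mul_cancel_right]

/-- The row relations express the action of `alpha`. The block relations hold because rows `2p - 1`
and `2p` differ by the central involution `(c, 1)`, whose two occurrences cancel or can be moved
across. -/
theorem modelA_mul_modelB {n : ℕ} {x y : ℕ × ℕ} (h : GridPair n x y) :
    modelA (n - 1) x.1 * modelB (n - 1) x.2 = modelA (n - 1) y.1 * modelB (n - 1) y.2 := by
  have hone : modelA (n - 1) 1 * modelA (n - 1) 1 = 1 := by
    ext1
    · rfl
    · simp only [modelA, Prod.mk_mul_mk, ← map_mul, c_mul_c]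
      rfl
  have hcc : modelA (n - 1) 2 * modelA (n - 1) 1 = (1, SemidirectProduct.inl (c, 1)) := by
    simp only [modelA, Prod.mk_mul_mk, ← map_mul, c_mul_c, mul_one]
  have hinl : ∀ (j : ℕ) (v : C2 × C2), 3 ≤ j → j ≤ 2 * n →
      modelA (n - 1) j * (1, SemidirectProduct.inl v) =
        (1, SemidirectProduct.inl (alpha v)) * modelA (n - 1) j := by
    intro j v h3 hj
    obtain ⟨j, rfl⟩ := Nat.exists_eq_add_of_le' h3
    simp only [modelA, Prod.mk_mul_mk, one_mul, mul_one]
    rw [inr_genN_mul_inl (by omega)]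
  have hB : ∀ j, 3 ≤ j → modelB (n - 1) j = modelA (n - 1) 1 * modelA (n - 1) j := by
    intro j h3
    obtain ⟨j, rfl⟩ := Nat.exists_eq_add_of_le' h3
    rfl
  have hodd : ∀ p, 2 ≤ p → modelA (n - 1) (2 * p - 1) =
      (1, SemidirectProduct.inr (genN (n - 1) (p - 2))) := by
    intro p hp
    obtain ⟨p, rfl⟩ := Nat.exists_eq_add_of_le' hp
    rw [show 2 * (p + 2) - 1 = 2 * p + 3 by omega, modelA, pow_mul, pow_two, c_mul_c, one_pow,
      show 2 * p / 2 = p by omega, Nat.add_sub_cancel]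
  have heven : ∀ p, 2 ≤ p → modelA (n - 1) (2 * p) = (c, 1) * modelA (n - 1) (2 * p - 1) := by
    intro p hp
    rw [hodd p hp]
    obtain ⟨p, rfl⟩ := Nat.exists_eq_add_of_le' hp
    rw [show 2 * (p + 2) = 2 * p + 1 + 3 by omega, modelA, pow_succ, pow_mul, pow_two, c_mul_c,
      one_pow, show (2 * p + 1) / 2 = p by omega, Nat.add_sub_cancel, Prod.mk_mul_mk, one_mul,
      one_mul, mul_one]
  have hcomm : ∀ z : Model (n - 1), z * (c, 1) = (c, 1) * z := fun z ↦ by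
    ext1
    · exact mul_comm _ _
    · simp
  have hc1 : ((c, 1) * (c, 1) : Model (n - 1)) = 1 := by
    ext1
    · exact c_mul_c
    · simp
  have hswap : ∀ x y z : Model (n - 1), (c, 1) * x * (y * ((c, 1) * z)) = x * (y * z) := by
    intro x y z
    rw [← mul_assoc y, hcomm y, ← hcomm x, mul_assoc x, mul_assoc _ y, ← mul_assoc (c, 1) (c, 1),
      hc1, one_mul]
  cases h with
  | corner_one => exact (one_mul _).trans (mul_one _).symm
  | corner_two => exact (one_mul _).trans (mul_one _).symm
  | cross_diag =>
    change modelA (n - 1) 1 * modelA (n - 1) 1 = modelA (n - 1) 2 * modelA (n - 1) 2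
    rw [hone]
    simp only [modelA, Prod.mk_mul_mk, ← map_mul, c_mul_c, mul_one]
    exact Prod.ext rfl (map_one SemidirectProduct.inl).symm
  | cross_anti =>
    change modelA (n - 1) 1 * modelA (n - 1) 2 = modelA (n - 1) 2 * modelA (n - 1) 1
    simp only [modelA, Prod.mk_mul_mk, ← map_mul, one_mul, mul_one]
  | block_diag p q hp hq =>
    dsimp only
    rw [hB _ (by omega), hB _ (by omega), heven p hp.1, heven q hq.1, hswap]
  | block_anti p q hp hq =>
    dsimp only
    rw [hB _ (by omega), hB _ (by omega), heven p hp.1, heven q hq.1, ← mul_assoc (modelA _ 1),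
      hcomm]
    simp only [mul_assoc]
    rw [← mul_assoc, hcomm, mul_assoc]
  | row_zero j hj =>
    dsimp only
    rw [hB _ hj.1]
    refine (one_mul _).trans ?_
    exact (hinl j (c, c) hj.1 hj.2).symm
  | row_one j hj =>
    dsimp only
    rw [hB _ hj.1, ← mul_assoc, hone, one_mul]
    exact (mul_one _).symm
  | row_two j hj =>
    dsimp only
    rw [hB _ hj.1, ← mul_assoc, hcc]
    exact (hinl j (1, c) hj.1 hj.2).symm

/-- The homomorphism to `ℤ` killing all generators except the `i`-th separates it from the others.
-/
theorem gen_injective {k : ℕ} : Function.Injective (gen (k := k)) := by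
  intro i j h
  by_contra hij
  have := congrArg (Monoid.CoprodI.lift fun l : Fin k ↦
    zpowersHom (Multiplicative ℤ) (if l = i then Multiplicative.ofAdd 1 else 1)) h
  rw [lift_zpowersHom_gen (fun l ↦ if l = i then Multiplicative.ofAdd (1 : ℤ) else 1),
    lift_zpowersHom_gen (fun l ↦ if l = i then Multiplicative.ofAdd (1 : ℤ) else 1),
    if_pos rfl, if_neg (Ne.symm hij)] at this
  exact absurd this (by decide)

theorem gen_ne_one {k : ℕ} (i : Fin k) : gen i ≠ 1 := by
  intro h
  have := congrArg (Monoid.CoprodI.lift fun _ : Fin k ↦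
    zpowersHom (Multiplicative ℤ) (Multiplicative.ofAdd 1)) h
  rw [lift_zpowersHom_gen (fun _ ↦ Multiplicative.ofAdd (1 : ℤ))] at this
  exact absurd (this.trans (map_one _)) (by decide)

/-- The free component separates the indices at most `2` from the rest, and the blocks from one
another. Within a block the first coordinate shows the parity; for indices at most `2` the component
in `C2 × C2` decides. -/
theorem modelA_injOn {n : ℕ} : Set.InjOn (modelA (n - 1)) {i | i < 2 * n + 1} := by
  have hright : ∀ j, j + 3 < 2 * n + 1 → (modelA (n - 1) (j + 3)).2.right ≠ 1 := by
    intro j hj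
    simp only [modelA, SemidirectProduct.right_inr, genN_of_lt (show j / 2 < n - 1 by omega)]
    exact gen_ne_one _
  have hsmall : ∀ i, i ≤ 2 → (modelA (n - 1) i).2.right = 1 := by
    intro i hi
    interval_cases i <;> rfl
  have hleft : ∀ i i', i ≤ 2 → i' ≤ 2 →
      (modelA (n - 1) i).2.left = (modelA (n - 1) i').2.left → i = i' := by
    intro i i' hi hi' h
    have hval : ∀ l : Fin 3, (modelA (n - 1) l).2.left =
        (![1, (1, c), (c, c)] : Fin 3 → C2 × C2) l := fun l ↦ by fin_cases l <;> rfl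
    have hinj : Function.Injective (![1, (1, c), (c, c)] : Fin 3 → C2 × C2) := by decide
    exact congrArg Fin.val (@hinj ⟨i, by omega⟩ ⟨i', by omega⟩
      ((hval ⟨i, by omega⟩).symm.trans (h.trans (hval ⟨i', by omega⟩))))
  intro i hi i' hi' h
  simp only [Set.mem_ofPred_eq] at hi hi'
  by_cases h2 : i ≤ 2 <;> by_cases h2' : i' ≤ 2
  · exact hleft i i' h2 h2' (by rw [h])
  · obtain ⟨j, rfl⟩ := Nat.exists_eq_add_of_le' (show 3 ≤ i' by omega)
    exact absurd (by rw [← h, hsmall i h2]) (hright j hi')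
  · obtain ⟨j, rfl⟩ := Nat.exists_eq_add_of_le' (show 3 ≤ i by omega)
    exact absurd (by rw [h, hsmall i' h2']) (hright j hi)
  · obtain ⟨j, rfl⟩ := Nat.exists_eq_add_of_le' (show 3 ≤ i by omega)
    obtain ⟨j', rfl⟩ := Nat.exists_eq_add_of_le' (show 3 ≤ i' by omega)
    have hr := congrArg (fun z ↦ z.2.right) h
    have hc := congrArg Prod.fst h
    simp only [modelA, SemidirectProduct.right_inr, genN_of_lt (show j / 2 < n - 1 by omega),
      genN_of_lt (show j' / 2 < n - 1 by omega)] at hr hc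
    have hd : j / 2 = j' / 2 := congrArg Fin.val (gen_injective hr)
    have hp : j % 2 = j' % 2 := by
      have ho : orderOf c = 2 := orderOf_eq_prime (by decide) (by decide)
      rw [pow_eq_pow_iff_modEq, ho] at hc
      exact hc
    omega

theorem modelB_injOn {n : ℕ} : Set.InjOn (modelB (n - 1)) {i | i < 2 * n + 1} := by
  have hB : ∀ j, 3 ≤ j → modelB (n - 1) j = modelA (n - 1) 1 * modelA (n - 1) j := by
    intro j h3
    obtain ⟨j, rfl⟩ := Nat.exists_eq_add_of_le' h3
    rfl
  have hs : ∀ j, j ≤ 2 → modelB (n - 1) j = modelA (n - 1) j := by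
    intro j hj
    interval_cases j <;> rfl
  have hright : ∀ j, 3 ≤ j → j < 2 * n + 1 → (modelB (n - 1) j).2.right ≠ 1 := by
    intro j h3 hj
    obtain ⟨j, rfl⟩ := Nat.exists_eq_add_of_le' h3
    rw [hB _ h3]
    simp only [modelA, Prod.snd_mul, SemidirectProduct.mul_right, SemidirectProduct.right_inl,
      one_mul, SemidirectProduct.right_inr, genN_of_lt (show j / 2 < n - 1 by omega)]
    exact gen_ne_one _
  have hsmall : ∀ i, i ≤ 2 → (modelB (n - 1) i).2.right = 1 := by
    intro i hi
    interval_cases i <;> rfl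
  intro i hi i' hi' h
  by_cases h2 : i ≤ 2 <;> by_cases h2' : i' ≤ 2
  · rw [hs i h2, hs i' h2'] at h
    exact modelA_injOn hi hi' h
  · exact absurd (by rw [← h, hsmall i h2]) (hright i' (by omega) hi')
  · exact absurd (by rw [h, hsmall i' h2']) (hright i (by omega) hi)
  · rw [hB i (by omega), hB i' (by omega), mul_right_inj] at h
    exact modelA_injOn hi hi' h

end Model

/-! ### Consequences of the defining relations -/

section Relations

/-- The relations of `Γ_π` for `π = gridPartition n`, in any group. Here `A i` and `B j` play the
roles of `aᵢ` and `bⱼ`. -/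
structure GridRelations (n : ℕ) {G : Type*} [Group G] (A B : ℕ → G) : Prop where
  A_zero : A 0 = 1
  B_zero : B 0 = 1
  rel : ∀ {x y}, GridPair n x y → A x.1 * B x.2 = A y.1 * B y.2

namespace GridRelations

variable {n : ℕ} {G : Type*} [Group G] {A B : ℕ → G}

theorem B_one (h : GridRelations n A B) : B 1 = A 1 := by
  simpa [h.A_zero, h.B_zero] using h.rel .corner_one

theorem B_two (h : GridRelations n A B) : B 2 = A 2 := by
  simpa [h.A_zero, h.B_zero] using h.rel .corner_two

theorem A_one_comm (h : GridRelations n A B) : A 1 * A 2 = A 2 * A 1 := by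
  simpa [h.B_one, h.B_two] using h.rel .cross_anti

theorem A_one_sq (h : GridRelations n A B) : A 1 * A 1 = A 2 * A 2 := by
  simpa [h.B_one, h.B_two] using h.rel .cross_diag

theorem s_sq (h : GridRelations n A B) : ((A 1)⁻¹ * A 2) * ((A 1)⁻¹ * A 2) = 1 := by
  have hc : Commute (A 1)⁻¹ (A 2) := (show Commute (A 1) (A 2) from h.A_one_comm).inv_left
  rw [mul_assoc, ← mul_assoc (A 2), ← hc.eq, mul_assoc, ← h.A_one_sq]
  group

theorem B_eq (h : GridRelations n A B) {j : ℕ} (hj : 3 ≤ j ∧ j ≤ 2 * n) : B j = A j * A 2 := by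
  simpa [h.A_zero, h.B_two] using h.rel (.row_zero j hj)

theorem A_one_mul (h : GridRelations n A B) {j : ℕ} (hj : 3 ≤ j ∧ j ≤ 2 * n) :
    A 1 * B j = A j := by
  simpa [h.B_zero] using h.rel (.row_one j hj)

/-- Eliminate `bⱼ` between the relations from rows `1` and `2`. -/
theorem A_mul_A_one (h : GridRelations n A B) {j : ℕ} (hj : 3 ≤ j ∧ j ≤ 2 * n) :
    A j * A 1 = (A 1)⁻¹ * A 2 * A j := by
  have h2 : A 2 * B j = A j * A 1 := by simpa [h.B_one] using h.rel (.row_two j hj)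
  have hc : Commute (A 1)⁻¹ (A 2) := (show Commute (A 1) (A 2) from h.A_one_comm).inv_left
  rw [← h2, hc.eq, mul_assoc, ← eq_inv_mul_iff_mul_eq.mpr (h.A_one_mul hj)]

/-- Conjugation by `a₃` carries `a₁` to `s`, whose square is `1`. -/
theorem A_one_mul_self (h : GridRelations n A B) (hn : 2 ≤ n) : A 1 * A 1 = 1 := by
  have h3 := h.A_mul_A_one (j := 3) ⟨le_rfl, by omega⟩
  have h4 : A 3 * (A 1 * A 1) = A 3 := by
    rw [← mul_assoc, h3, mul_assoc, h3, ← mul_assoc, h.s_sq, one_mul]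
  exact mul_eq_left.mp h4

theorem A_one_inv (h : GridRelations n A B) (hn : 2 ≤ n) : (A 1)⁻¹ = A 1 :=
  inv_eq_of_mul_eq_one_left (h.A_one_mul_self hn)

theorem B_eq' (h : GridRelations n A B) (hn : 2 ≤ n) {j : ℕ} (hj : 3 ≤ j ∧ j ≤ 2 * n) :
    B j = A 1 * A j := by
  rw [← h.A_one_mul hj, ← mul_assoc, h.A_one_mul_self hn, one_mul]

theorem commute_s_A_one (h : GridRelations n A B) : Commute ((A 1)⁻¹ * A 2) (A 1) :=
  (Commute.refl (A 1)).inv_left.mul_left (show Commute (A 1) (A 2) from h.A_one_comm).symm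

/-- With `A_mul_A_one`, this says that conjugation by `aⱼ` is `alpha` on `⟨s, a₁⟩`, whatever `j` is.
-/
theorem A_mul_s (h : GridRelations n A B) (hn : 2 ≤ n) {j : ℕ} (hj : 3 ≤ j ∧ j ≤ 2 * n) :
    A j * ((A 1)⁻¹ * A 2) = (A 1)⁻¹ * A 2 * A 1 * A j := by
  have h2 : A j * A 2 = A 1 * A j := by rw [← h.B_eq hj, h.B_eq' hn hj]
  rw [h.A_one_inv hn, ← mul_assoc, h.A_mul_A_one hj, mul_assoc, h2, h.A_one_inv hn, mul_assoc _ _ (A j)]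

/-- Conjugation by `aⱼ⁻¹ aₖ` is trivial on `a₁` and `s`, for `j, k ≥ 3`. -/
theorem commute_A_inv_mul_A (h : GridRelations n A B) (hn : 2 ≤ n) {j k : ℕ}
    (hj : 3 ≤ j ∧ j ≤ 2 * n) (hk : 3 ≤ k ∧ k ≤ 2 * n) :
    Commute ((A j)⁻¹ * A k) (A 1) ∧ Commute ((A j)⁻¹ * A k) ((A 1)⁻¹ * A 2) := by
  constructor
  · rw [commute_iff_eq, mul_assoc, h.A_mul_A_one hk, inv_mul_eq_iff_eq_mul, ← mul_assoc, ← mul_assoc,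
      h.A_mul_A_one hj]
    group
  · rw [commute_iff_eq, mul_assoc, h.A_mul_s hn hk, inv_mul_eq_iff_eq_mul, ← mul_assoc (A j),
      h.A_mul_s hn hj]
    group

/-- The relations on the blocks determine `a_{2q}` from `a_{2q-1}` and any of the elements
`a_{2p-1}⁻¹ a_{2p}`, which have square one. -/
theorem block (h : GridRelations n A B) (hn : 2 ≤ n) {p q : ℕ} (hp : 2 ≤ p ∧ p ≤ n)
    (hq : 2 ≤ q ∧ q ≤ n) :
    A (2 * q) = A 1 * ((A (2 * p - 1))⁻¹ * A (2 * p)) * A 1 * A (2 * q - 1) ∧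
      (A (2 * p - 1))⁻¹ * A (2 * p) * ((A (2 * p - 1))⁻¹ * A (2 * p)) = 1 := by
  have h1 := h.rel (.block_diag p q hp hq)
  have h2 := h.rel (.block_anti p q hp hq)
  dsimp only at h1 h2
  rw [h.B_eq' hn ⟨by omega, by omega⟩, h.B_eq' hn ⟨by omega, by omega⟩] at h1 h2
  set X := A (2 * p - 1)
  set Y := A (2 * p)
  set X' := A (2 * q - 1)
  set Y' := A (2 * q)
  -- Left multiplication by `X⁻¹Y` exchanges `a₁X'` and `a₁Y'`, so its square is trivial.
  have h2' : A 1 * Y' = X⁻¹ * Y * (A 1 * X') := by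
    rw [mul_assoc, ← h2, inv_mul_cancel_left]
  have h1' : A 1 * X' = X⁻¹ * Y * (A 1 * Y') := by
    rw [mul_assoc, ← h1, inv_mul_cancel_left]
  constructor
  · rw [mul_assoc, mul_assoc, ← h2', ← mul_assoc, h.A_one_mul_self hn, one_mul]
  · rw [h2', ← mul_assoc] at h1'
    exact mul_eq_right.mp h1'.symm

theorem t_sq (h : GridRelations n A B) (hn : 2 ≤ n) :
    (A 3)⁻¹ * A 4 * ((A 3)⁻¹ * A 4) = 1 :=
  (h.block hn (p := 2) (q := 2) ⟨le_rfl, hn⟩ ⟨le_rfl, hn⟩).2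

theorem commute_t (h : GridRelations n A B) (hn : 2 ≤ n) :
    Commute ((A 3)⁻¹ * A 4) (A 1) ∧ Commute ((A 3)⁻¹ * A 4) ((A 1)⁻¹ * A 2) :=
  h.commute_A_inv_mul_A hn ⟨by omega, by omega⟩ ⟨by omega, by omega⟩

theorem A_even (h : GridRelations n A B) (hn : 2 ≤ n) {q : ℕ} (hq : 2 ≤ q ∧ q ≤ n) :
    A (2 * q) = (A 3)⁻¹ * A 4 * A (2 * q - 1) := by
  have h1 := (h.block hn (p := 2) ⟨le_rfl, hn⟩ hq).1
  change _ = A 1 * ((A 3)⁻¹ * A 4) * A 1 * A (2 * q - 1) at h1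
  rwa [← (h.commute_t hn).1.eq, mul_assoc _ (A 1) (A 1), h.A_one_mul_self hn, mul_one] at h1

/-- Exchanging the roles of the blocks `2` and `q` in `block` identifies `a_{2q-1}⁻¹a_{2q}` with
`t`. Together with `A_even` this makes `t` commute with `a_{2q-1}`. -/
theorem A_even' (h : GridRelations n A B) (hn : 2 ≤ n) {q : ℕ} (hq : 2 ≤ q ∧ q ≤ n) :
    A (2 * q) = A (2 * q - 1) * ((A 3)⁻¹ * A 4) := by
  have h1 := (h.block hn (p := q) (q := 2) hq ⟨le_rfl, hn⟩).1
  change A 4 = A 1 * ((A (2 * q - 1))⁻¹ * A (2 * q)) * A 1 * A 3 at h1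
  have hc := (h.commute_A_inv_mul_A hn (j := 2 * q - 1) (k := 2 * q)
    ⟨by omega, by omega⟩ ⟨by omega, by omega⟩).1
  rw [← hc.eq, mul_assoc _ (A 1) (A 1), h.A_one_mul_self hn, mul_one] at h1
  have h2 := h.A_even hn (q := 2) ⟨le_rfl, hn⟩
  change A 4 = (A 3)⁻¹ * A 4 * A 3 at h2
  rw [mul_right_cancel (h2.symm.trans h1), mul_inv_cancel_left]

theorem commute_t_A (h : GridRelations n A B) (hn : 2 ≤ n) {q : ℕ} (hq : 2 ≤ q ∧ q ≤ n) :
    Commute ((A 3)⁻¹ * A 4) (A (2 * q - 1)) :=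
  (h.A_even hn hq).symm.trans (h.A_even' hn hq)

end GridRelations

end Relations

/-! ### Homomorphisms out of the model group -/

section InverseMap

/-- The homomorphism from the cyclic group of order two given by an element of square one. -/
def c2Hom {G : Type*} [Group G] (g : G) (hg : g * g = 1) : C2 →* G where
  toFun x := if x = 1 then 1 else g
  map_one' := if_pos rfl
  map_mul' x y := by
    have hx : ∀ x : C2, x = 1 ∨ x = c := by decide
    have hc : c ≠ 1 := by decide
    rcases hx x with rfl | rfl <;> rcases hx y with rfl | rfl <;> simp [hc, c_mul_c, hg]

@[simp]
theorem c2Hom_c {G : Type*} [Group G] (g : G) (hg : g * g = 1) : c2Hom g hg c = g :=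
  if_neg (t := 1) (show c ≠ 1 by decide)

theorem commute_c2Hom {G : Type*} [Group G] {g x : G} (hg : g * g = 1) (h : Commute g x) (u : C2) :
    Commute (c2Hom g hg u) x := by
  change Commute (if u = 1 then 1 else g) x
  split_ifs
  exacts [Commute.one_left x, h]

theorem c2_hom_ext {G : Type*} [Monoid G] {f g : C2 →* G} (h : f c = g c) : f = g := by
  have hx : ∀ x : C2, x = 1 ∨ x = c := by decide
  ext x
  rcases hx x with rfl | rfl
  exacts [(map_one f).trans (map_one g).symm, h]

theorem prod_hom_ext {M N P : Type*} [Monoid M] [Monoid N] [Monoid P] {f g : M × N →* P}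
    (h₁ : f.comp (MonoidHom.inl M N) = g.comp (MonoidHom.inl M N))
    (h₂ : f.comp (MonoidHom.inr M N) = g.comp (MonoidHom.inr M N)) : f = g := by
  ext ⟨x, y⟩
  have hxy : (x, y) = MonoidHom.inl M N x * MonoidHom.inr M N y := by simp
  rw [hxy, map_mul, map_mul]
  exact congrArg₂ _ (DFunLike.congr_fun h₁ x) (DFunLike.congr_fun h₂ y)

theorem c2_prod_hom_ext {G : Type*} [Monoid G] {f g : C2 × C2 →* G}
    (h₁ : f (c, 1) = g (c, 1)) (h₂ : f (1, c) = g (1, c)) : f = g :=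
  prod_hom_ext (c2_hom_ext h₁) (c2_hom_ext h₂)

theorem freeProdZ_hom_ext {k : ℕ} {G : Type*} [Group G] {f g : FreeProdZ k →* G}
    (h : ∀ i, f (gen i) = g (gen i)) : f = g := by
  apply MonoidHom.eq_of_eqOn_dense (closure_range_gen k)
  rintro _ ⟨i, rfl⟩
  exact h i

theorem model_hom_ext {k : ℕ} {G : Type*} [Group G] {f g : Model k →* G}
    (h₁ : f (c, 1) = g (c, 1))
    (h₂ : f (1, SemidirectProduct.inl (c, 1)) = g (1, SemidirectProduct.inl (c, 1)))
    (h₃ : f (1, SemidirectProduct.inl (1, c)) = g (1, SemidirectProduct.inl (1, c)))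
    (h₄ : ∀ i, f (1, SemidirectProduct.inr (gen i)) = g (1, SemidirectProduct.inr (gen i))) :
    f = g :=
  prod_hom_ext (c2_hom_ext h₁)
    (SemidirectProduct.hom_ext (c2_prod_hom_ext h₂ h₃) (freeProdZ_hom_ext h₄))

/-- A homomorphism from the model group is given by elements `t, s, a` and `x i` satisfying the
relations of its standard generators. -/
theorem exists_model_hom {k : ℕ} {G : Type*} [Group G] (t s a : G) (x : Fin k → G)
    (ht : t * t = 1) (hs : s * s = 1) (ha : a * a = 1) (hsa : Commute s a) (hta : Commute t a)
    (hts : Commute t s) (htx : ∀ i, Commute t (x i)) (hxa : ∀ i, x i * a = s * x i)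
    (hxs : ∀ i, x i * s = s * a * x i) :
    ∃ ψ : Model k →* G, ψ (c, 1) = t ∧ ψ (1, SemidirectProduct.inl (c, 1)) = s ∧
      ψ (1, SemidirectProduct.inl (1, c)) = a ∧
      ∀ i, ψ (1, SemidirectProduct.inr (gen i)) = x i := by
  let fn : C2 × C2 →* G := (c2Hom s hs).noncommCoprod (c2Hom a ha) fun u v ↦
    commute_c2Hom hs (commute_c2Hom ha hsa.symm v).symm u
  have fn_s : fn (c, 1) = s := by simp [fn]
  have fn_a : fn (1, c) = a := by simp [fn]
  have fn_sa : fn (c, c) = s * a := by simp [fn]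
  let fg : FreeProdZ k →* G := Monoid.CoprodI.lift fun i ↦ zpowersHom G (x i)
  have fg_gen : ∀ i, fg (gen i) = x i := lift_zpowersHom_gen x
  -- Equivariance need only be checked on generators of both factors, where it is exactly `hxs` and
  -- `hxa`.
  have hcompat : ∀ g, fn.comp (act k g).toMonoidHom = (MulAut.conj (fg g)).toMonoidHom.comp fn := by
    suffices H : ∀ g v, fn (act k g v) = fg g * fn v * (fg g)⁻¹ from
      fun g ↦ MonoidHom.ext fun v ↦ H g v
    intro g
    have hg : g ∈ Subgroup.closure (Set.range (gen (k := k))) := by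
      rw [closure_range_gen]
      exact Subgroup.mem_top g
    induction hg using Subgroup.closure_induction with
    | mem g hg =>
      obtain ⟨i, rfl⟩ := hg
      have : fn.comp alpha.toMonoidHom = (MulAut.conj (x i)).toMonoidHom.comp fn := by
        apply c2_prod_hom_ext
        · change fn (c, c) = x i * fn (c, 1) * (x i)⁻¹
          rw [fn_sa, fn_s, hxs, mul_inv_cancel_right]
        · change fn (c, 1) = x i * fn (1, c) * (x i)⁻¹
          rw [fn_s, fn_a, hxa, mul_inv_cancel_right]
      intro v
      rw [act_gen, fg_gen]
      exact DFunLike.congr_fun this v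
    | one => simp
    | mul g g' _ _ ih ih' =>
      intro v
      rw [map_mul, MulAut.mul_apply, ih, ih', map_mul]
      group
    | inv g _ ih =>
      intro v
      have := ih ((act k g)⁻¹ v)
      rw [MulAut.apply_inv_self] at this
      rw [this, map_inv, map_inv]
      group
  let f₂ := SemidirectProduct.lift fn fg hcompat
  have hcomm : ∀ u v, Commute (c2Hom t ht u) (f₂ v) := by
    intro u v
    refine commute_c2Hom ht ?_ u
    change Commute t (fn v.left * fg v.right)
    refine Commute.mul_right ?_ ?_
    · exact ((commute_c2Hom hs hts.symm _).mul_left (commute_c2Hom ha hta.symm _)).symm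
    · have hconj : (MulAut.conj t).toMonoidHom.comp fg = fg := freeProdZ_hom_ext fun i ↦ by
        change t * fg (gen i) * t⁻¹ = fg (gen i)
        rw [fg_gen, (htx i).eq, mul_inv_cancel_right]
      exact mul_inv_eq_iff_eq_mul.mp (DFunLike.congr_fun hconj v.right)
  refine ⟨(c2Hom t ht).noncommCoprod f₂ hcomm, ?_, ?_, ?_, fun i ↦ ?_⟩
  · simp
  · simp [f₂, fn_s]
  · simp [f₂, fn_a]
  · simp [f₂, fg_gen]

end InverseMap

/-! ### The isomorphism with the model group -/

section Isomorphism

/-- The generator `aᵢ`, extended by `1` to all natural numbers. -/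
def gamA (n i : ℕ) : Gam (gridPartition n) :=
  if h : i < 2 * n + 1 then a (gridPartition n) ⟨i, h⟩ else 1

/-- The generator `bⱼ`, extended by `1` to all natural numbers. -/
def gamB (n j : ℕ) : Gam (gridPartition n) :=
  if h : j < 2 * n + 1 then b (gridPartition n) ⟨j, h⟩ else 1

theorem gamA_of_lt {n i : ℕ} (h : i < 2 * n + 1) : gamA n i = a (gridPartition n) ⟨i, h⟩ :=
  dif_pos h

theorem gamB_of_lt {n j : ℕ} (h : j < 2 * n + 1) : gamB n j = b (gridPartition n) ⟨j, h⟩ :=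
  dif_pos h

theorem a_mul_b_eq {m n : ℕ} {π : Setoid (Fin m × Fin n)} {x y : Fin m × Fin n} (h : π x y) :
    a π x.1 * b π x.2 = a π y.1 * b π y.2 := by
  have := PresentedGroup.one_of_mem (rels := relators π) (.inr (.inr ⟨x, y, h, rfl⟩))
  rw [map_mul, map_inv, mul_inv_eq_one, map_mul, map_mul] at this
  exact this

theorem gridRelations_gam {n : ℕ} (hn : 2 ≤ n) : GridRelations n (gamA n) (gamB n) where
  A_zero := by
    rw [gamA_of_lt (by omega)]
    exact PresentedGroup.one_of_mem (rels := relators (gridPartition n)) (.inl ⟨_, rfl, rfl⟩)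
  B_zero := by
    rw [gamB_of_lt (by omega)]
    exact PresentedGroup.one_of_mem (rels := relators (gridPartition n)) (.inr (.inl ⟨_, rfl, rfl⟩))
  rel {x y} h := by
    obtain ⟨h1, h2, h3, h4⟩ := h.lt hn
    rw [gamA_of_lt h1, gamB_of_lt h2, gamA_of_lt h3, gamB_of_lt h4]
    exact a_mul_b_eq (x := (⟨x.1, h1⟩, ⟨x.2, h2⟩)) (y := (⟨y.1, h3⟩, ⟨y.2, h4⟩))
      (gridPartition_of_gridPair h)

/-- There is a homomorphism from `Γ_π` to the model group with the expected values. -/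
theorem exists_hom_to_model (n : ℕ) : ∃ φ : Gam (gridPartition n) →* Model (n - 1),
    (∀ i, φ (a (gridPartition n) i) = modelA (n - 1) i) ∧
      ∀ j, φ (b (gridPartition n) j) = modelB (n - 1) j := by
  let f : Fin (2 * n + 1) ⊕ Fin (2 * n + 1) → Model (n - 1) :=
    Sum.elim (fun i ↦ modelA (n - 1) i) (fun j ↦ modelB (n - 1) j)
  have hf : ∀ r ∈ relators (gridPartition n), FreeGroup.lift f r = 1 := by
    rintro _ (⟨⟨i, hi⟩, rfl, rfl⟩ | ⟨⟨j, hj⟩, rfl, rfl⟩ | ⟨x, y, h, rfl⟩)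
    · rw [FreeGroup.lift_apply_of]; rfl
    · rw [FreeGroup.lift_apply_of]; rfl
    · simp only [map_mul, map_inv, FreeGroup.lift_apply_of, mul_inv_eq_one]
      simp only [f, Sum.elim_inl, Sum.elim_inr]
      -- The relators range over the whole generated equivalence relation; equality of products
      -- passes from the listed pairs to it.
      induction h with
      | rel x y h => exact modelA_mul_modelB h
      | refl x => rfl
      | symm x y _ ih => exact ih.symm
      | trans x y z _ _ ih ih' => exact ih.trans ih'
  exact ⟨PresentedGroup.toGroup hf, fun i ↦ PresentedGroup.toGroup.of hf,
    fun j ↦ PresentedGroup.toGroup.of hf⟩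

theorem exists_gam_mulEquiv_model {n : ℕ} (hn : 2 ≤ n) :
    ∃ e : Gam (gridPartition n) ≃* Model (n - 1),
      (∀ i, e (a (gridPartition n) i) = modelA (n - 1) i) ∧
        ∀ j, e (b (gridPartition n) j) = modelB (n - 1) j := by
  obtain ⟨φ, hφa, hφb⟩ := exists_hom_to_model n
  have h := gridRelations_gam hn
  have hφA : ∀ i, i < 2 * n + 1 → φ (gamA n i) = modelA (n - 1) i := fun i hi ↦ by
    rw [gamA_of_lt hi, hφa]
  have hodd : ∀ i : Fin (n - 1), 2 * i.val + 3 = 2 * (i.val + 2) - 1 := fun i ↦ by omega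
  obtain ⟨ψ, hψt, hψs, hψa, hψx⟩ := exists_model_hom (k := n - 1) ((gamA n 3)⁻¹ * gamA n 4)
    ((gamA n 1)⁻¹ * gamA n 2) (gamA n 1) (fun i ↦ gamA n (2 * i + 3)) (h.t_sq hn) h.s_sq
    (h.A_one_mul_self hn) h.commute_s_A_one (h.commute_t hn).1 (h.commute_t hn).2
    (fun i ↦ by rw [hodd]; exact h.commute_t_A hn (by omega)) (fun i ↦ h.A_mul_A_one (by omega))
    (fun i ↦ h.A_mul_s hn (by omega))
  -- Each `aᵢ` is recovered from `t, s, a₁` and the odd-indexed generators; the even indices from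
  -- `4` on rely on `A_even`.
  have hψA : ∀ i, i < 2 * n + 1 → ψ (modelA (n - 1) i) = gamA n i := by
    intro i hi
    match i with
    | 0 => exact (map_one ψ).trans h.A_zero.symm
    | 1 => exact hψa
    | 2 =>
      have : modelA (n - 1) 2 =
          (1, SemidirectProduct.inl (1, c)) * (1, SemidirectProduct.inl (c, 1)) := by
        simp only [modelA, Prod.mk_mul_mk, ← map_mul, one_mul, mul_one]
      rw [this, map_mul, hψa, hψs, mul_inv_cancel_left]
    | j + 3 =>
      have hx : ψ (1, SemidirectProduct.inr (genN (n - 1) (j / 2))) = gamA n (2 * (j / 2) + 3) := by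
        rw [genN_of_lt (by omega), hψx]
      have hsplit : modelA (n - 1) (j + 3) =
          (c, 1) ^ j * (1, SemidirectProduct.inr (genN (n - 1) (j / 2))) := by
        simp only [modelA, Prod.pow_mk, Prod.mk_mul_mk, one_pow, one_mul, mul_one]
      rw [hsplit, map_mul, map_pow, hψt, hx]
      obtain ⟨l, rfl | rfl⟩ : ∃ l, j = 2 * l ∨ j = 2 * l + 1 := ⟨j / 2, by omega⟩
      · rw [pow_mul, pow_two, h.t_sq hn, one_pow, one_mul, show 2 * l / 2 = l by omega]
      · rw [pow_succ, pow_mul, pow_two, h.t_sq hn, one_pow, one_mul,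
          show (2 * l + 1) / 2 = l by omega, show 2 * l + 3 = 2 * (l + 2) - 1 by omega,
          show 2 * l + 1 + 3 = 2 * (l + 2) by omega]
        exact (h.A_even hn (by omega)).symm
  have hψB : ∀ j, j < 2 * n + 1 → ψ (modelB (n - 1) j) = gamB n j := by
    intro j hj
    match j with
    | 0 => exact (map_one ψ).trans h.B_zero.symm
    | 1 => exact (hψA 1 hj).trans h.B_one.symm
    | 2 => exact (hψA 2 hj).trans h.B_two.symm
    | j + 3 =>
      rw [h.B_eq' hn (by omega), ← hψA 1 (by omega), ← hψA (j + 3) hj, ← map_mul]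
      rfl
  have h₁ : ψ.comp φ = MonoidHom.id _ := PresentedGroup.ext fun z ↦ by
    rcases z with i | j
    · change ψ (φ (a (gridPartition n) i)) = a (gridPartition n) i
      rw [hφa, hψA i i.2, gamA_of_lt i.2]
    · change ψ (φ (b (gridPartition n) j)) = b (gridPartition n) j
      rw [hφb, hψB j j.2, gamB_of_lt j.2]
  have h₂ : φ.comp ψ = MonoidHom.id _ := by
    apply model_hom_ext
    · change φ (ψ _) = _
      rw [hψt, map_mul, map_inv, hφA 3 (by omega), hφA 4 (by omega), inv_mul_eq_iff_eq_mul]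
      exact Prod.ext rfl (mul_one _).symm
    · change φ (ψ _) = _
      rw [hψs, map_mul, map_inv, hφA 1 (by omega), hφA 2 (by omega), inv_mul_eq_iff_eq_mul]
      simp only [modelA, MonoidHom.id_apply, Prod.mk_mul_mk, ← map_mul, one_mul, mul_one]
    · change φ (ψ _) = _
      rw [hψa, hφA 1 (by omega)]
      rfl
    · intro i
      change φ (ψ _) = _
      rw [hψx, hφA _ (by omega), modelA, pow_mul, pow_two, c_mul_c, one_pow,
        genN_of_lt (by omega)]
      simp
  exact ⟨φ.toMulEquiv ψ h₁ h₂, hφa, hφb⟩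

end Isomorphism

end ULIE

/-! ### The main theorem -/

theorem mainTheorem5 (n : ℕ) (hn : 2 ≤ n) :
    ULIE.IsPairPartition (ULIE.gridPartition n) ∧
    ULIE.IsULIE1Partition (ZMod 2) (ULIE.gridPartition n) ∧
    ULIE.IsULIE1Group (ZMod 2) (2 * n + 1) (2 * n + 1) (ULIE.Gam (ULIE.gridPartition n)) ∧
    orderOf ULIE.alpha = 3 ∧
    (∃ e : ULIE.Gam (ULIE.gridPartition n) ≃* ULIE.Model (n - 1),
      e (ULIE.a (ULIE.gridPartition n) ⟨1, by omega⟩) =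
        (1, SemidirectProduct.inl (1, ULIE.c)) ∧
      e ((ULIE.a (ULIE.gridPartition n) ⟨1, by omega⟩)⁻¹ *
          ULIE.a (ULIE.gridPartition n) ⟨2, by omega⟩) =
        (1, SemidirectProduct.inl (ULIE.c, 1)) ∧
      ∀ k : Fin (n - 1),
        e (ULIE.a (ULIE.gridPartition n) ⟨2 * k.val + 3, by omega⟩) =
          (1, SemidirectProduct.inr (ULIE.gen k)) ∧
        e ((ULIE.a (ULIE.gridPartition n) ⟨2 * k.val + 3, by omega⟩)⁻¹ *
            ULIE.a (ULIE.gridPartition n) ⟨2 * k.val + 4, by omega⟩) =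
          (ULIE.c, 1)) ∧
    (3 ≤ n → ¬ ULIE.IsAmenable (ULIE.Gam (ULIE.gridPartition n))) ∧
    ULIE.IsSofic (ULIE.Gam (ULIE.gridPartition n)) := by
  obtain ⟨e, hea, heb⟩ := ULIE.exists_gam_mulEquiv_model hn
  have hnd : ULIE.Nondegenerate (ULIE.gridPartition n) := by
    constructor
    · intro i i' h
      exact Fin.ext (ULIE.modelA_injOn i.2 i'.2 (by rw [← hea, ← hea, h]))
    · intro j j' h
      exact Fin.ext (ULIE.modelB_injOn j.2 j'.2 (by rw [← heb, ← heb, h]))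
  have hU : ULIE.IsULIE1Partition (ZMod 2) (ULIE.gridPartition n) :=
    ⟨by omega, by omega, hnd, ULIE.minimallyRealizable_gridPartition hn,
      ULIE.rowConnected_gridPartition hn, ULIE.columnConnected_gridPartition hn⟩
  refine ⟨ULIE.isPairPartition_gridPartition hn, hU, ⟨_, hU, ⟨MulEquiv.refl _⟩⟩,
    ULIE.orderOf_alpha, ⟨e, hea _, ?_, fun k ↦ ?_⟩, fun h3 ↦ ?_, ?_⟩
  · rw [map_mul, map_inv, hea, hea, inv_mul_eq_iff_eq_mul]
    simp only [ULIE.modelA, Prod.mk_mul_mk, ← map_mul, one_mul, mul_one]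
  · have hk : e (ULIE.a (ULIE.gridPartition n) ⟨2 * k.val + 3, by omega⟩) =
        (1, SemidirectProduct.inr (ULIE.gen k)) := by
      rw [hea]
      simp only [ULIE.modelA]
      rw [pow_mul, pow_two, ULIE.c_mul_c, one_pow, ULIE.genN_of_lt (by omega)]
      simp
    refine ⟨hk, ?_⟩
    rw [map_mul, map_inv, hk, hea, inv_mul_eq_iff_eq_mul]
    simp only [ULIE.modelA]
    rw [pow_succ, pow_mul, pow_two, ULIE.c_mul_c, one_pow, ULIE.genN_of_lt (by omega),
      Prod.mk_mul_mk, mul_one]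
    simp [show (2 * k.val + 1) / 2 = k.val by omega]
  -- For `n ≥ 3` the free quotient has `n - 1 ≥ 2` factors.
  · refine ULIE.not_isAmenable_of_surjective (k := n - 1) (by omega)
      ((SemidirectProduct.rightHom.comp (MonoidHom.snd _ _)).comp e.toMonoidHom) fun x ↦ ?_
    obtain ⟨y, hy⟩ := e.surjective (1, SemidirectProduct.inr x)
    exact ⟨y, by simp [hy]⟩
  · have := ULIE.residuallyFinite_of_mulEquiv e
    exact ULIE.isSofic_of_residuallyFinite _
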